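/- Let $(\mathcal F,\tau)$ be a tracial von Neumann algebra, that is, $\mathcal F$ is a von Neumann algebra and $\tau:\mathcal F\to\mathbb C$ is a faithful normal tracial state: a positive linear functional with $\tau(1)=1$ and $\tau(ab)=\tau(ba)$ for all $a,b\in\mathcal F$, with $\tau(a)\neq0$ for every nonzero positive semidefinite $a\in\mathcal F$, and which preserves suprema of bounded increasing nets of positive semidefinite elements (such an $\mathcal F$ is automatically finite). Then for every integer $n\ge1$ and all positive semidefinite $f_1,\dots,f_n\in\mathcal F$, $$\frac{\tau(f_1+\cdots+f_n)}{n}\;\ge\;\tau\!\left(\left(\left(f_1^{1/2}\cdots f_n^{1/2}\right)^{*}\left(f_1^{1/2}\cdots f_n^{1/2}\right)\right)^{1/n}\right).$$ -/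

import Mathlib

open scoped ComplexOrder

/-- A faithful normal tracial state `τ` on a C⋆-algebra `M` (in the application a von Neumann
algebra). The order on `M` is the usual one, `0 ≤ a` meaning that `a` is positive semidefinite, and
the order on `ℂ` is the usual partial order (`z ≤ w` iff `w - z` is a nonnegative real number). -/
structure IsFaithfulNormalTracialState {M : Type*} [CStarAlgebra M] [PartialOrder M]
    [StarOrderedRing M] (τ : M →ₚ[ℂ] ℂ) : Prop where
  /-- `τ` is a state. -/
  map_one : τ 1 = 1
  /-- `τ` is tracial. -/
  map_mul_comm : ∀ a b : M, τ (a * b) = τ (b * a)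
  /-- `τ` is faithful. -/
  faithful : ∀ a : M, 0 ≤ a → τ a = 0 → a = 0
  /-- `τ` is normal: it preserves suprema of bounded increasing families of positive elements. -/
  normal : ∀ (S : Set M) (a : M), S.Nonempty → DirectedOn (· ≤ ·) S → (∀ s ∈ S, 0 ≤ s) →
    IsLUB S a → IsLUB (τ '' S) (τ a)

/-- `(M, τ)` is a tracial von Neumann algebra: `M` is a von Neumann algebra (a C⋆-algebra with a
Banach space predual) and `τ` is a faithful normal tracial state on it. The von Neumann algebra `M`
is then automatically finite, since it carries a faithful tracial state. -/
structure IsTracialVonNeumannAlgebra (M : Type*) [CStarAlgebra M] [PartialOrder M]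
    [StarOrderedRing M] (τ : M →ₚ[ℂ] ℂ) : Prop where
  wStarAlgebra : WStarAlgebra M
  isFaithfulNormalTracialState : IsFaithfulNormalTracialState τ

/-!
Write `f₁^{1/2} ⋯ fₙ^{1/2} = f₁^{1/2} * y`, where `y` is the product of the last `m = n - 1` factors,
so that the element on the right-hand side is `(y⋆ f₁ y)^{1/n}`. The theorem follows by induction
on `n` from the inequality

`n * τ ((y⋆ f₁ y)^{1/n}) ≤ τ f₁ + m * τ ((y⋆ y)^{1/m})`.

The latter is an instance of the tangent line inequality for the concave function `x ↦ x^{1/n}` under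
the trace: for `k ≥ 0` and `d` positive and invertible,

`n * τ k ≤ τ (k^n * d^{-m}) + m * τ d`.

This one is purely algebraic: `j ↦ τ (k^j * d^{1-j})` is a convex sequence, because its second
differences are `τ (k^j * ((k - d) * d^{-(j+1)} * (k - d)))`, a trace of a product of two positive
elements. Hence its value at `n` lies above the line through its values `τ d` at `0` and `τ k` at
`1` (`mul_trace_le_trace_pow_mul_inv_pow`).

Take now `k = (y⋆ f₁ y)^{1/n}` and `d = (y⋆ y)^{1/m} + δ` with `δ > 0`. As `d^m ≥ y⋆ y`, we have
`y d^{-m} y⋆ ≤ 1` (`mul_mul_star_le_one`), so `τ (k^n * d^{-m}) = τ (f₁ * (y d^{-m} y⋆)) ≤ τ f₁`, and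
`δ → 0` gives the claim.
-/

/-! ### Convex sequences -/

theorem add_mul_sub_le_of_convex {a : ℕ → ℝ} (ha : ∀ j, 2 * a (j + 1) ≤ a j + a (j + 2)) (n : ℕ) :
    a 0 + n * (a 1 - a 0) ≤ a n := by
  have hinc : ∀ j, a 1 - a 0 ≤ a (j + 1) - a j := by
    intro j
    induction j with
    | zero => simp
    | succ j ih => linarith [ha j]
  induction n with
  | zero => simp
  | succ n ih =>
    push_cast
    linarith [hinc n]

section CStar

variable {M : Type*} [CStarAlgebra M] [PartialOrder M] [StarOrderedRing M]

/-! ### Order inequalities in C⋆-algebras -/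

/-- If `c` is a positive inverse of some `b ≥ y⋆ y`, then `y c y⋆` is a contraction. With
`w = y c y⋆`, this holds because `1 - w = (1 - w)² + (w - w²)` and `w - w² = (y c) (b - y⋆ y) (y c)⋆`. -/
theorem mul_mul_star_le_one {y b c : M} (hc : 0 ≤ c) (hcb : c * b = 1) (hb : star y * y ≤ b) :
    y * c * star y ≤ 1 := by
  have hcs : star c = c := (IsSelfAdjoint.of_nonneg hc).star_eq
  have h₁ : 0 ≤ star (1 - y * c * star y) * (1 - y * c * star y) := star_mul_self_nonneg _
  have h₂ : 0 ≤ (y * c) * (b - star y * y) * star (y * c) :=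
    star_right_conjugate_nonneg (sub_nonneg.2 hb) _
  have h₃ : y * c * b = y := by rw [mul_assoc, hcb, mul_one]
  have h₄ : star (1 - y * c * star y) * (1 - y * c * star y) +
      (y * c) * (b - star y * y) * star (y * c) = 1 - y * c * star y := by
    rw [mul_sub (y * c), h₃]
    simp only [star_sub, star_one, star_mul, star_star, hcs]
    noncomm_ring
  exact sub_nonneg.1 (h₄ ▸ add_nonneg h₁ h₂)

theorem pow_le_add_algebraMap_pow {z : M} (hz : 0 ≤ z) {δ : ℝ} (hδ : 0 ≤ δ) (m : ℕ) :
    z ^ m ≤ (z + algebraMap ℝ M δ) ^ m := by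
  have hδ' : 0 ≤ algebraMap ℝ M δ := algebraMap_nonneg M hδ
  have hcomm : Commute z (algebraMap ℝ M δ) := Algebra.commute_algebraMap_right δ z
  induction m with
  | zero => simp
  | succ m ih =>
    have hzd : Commute z (z + algebraMap ℝ M δ) := (Commute.refl z).add_right hcomm
    calc z ^ (m + 1) = z * z ^ m := pow_succ' z m
      _ ≤ z * (z + algebraMap ℝ M δ) ^ m := by
        rw [← sub_nonneg, ← mul_sub]
        exact Commute.mul_nonneg hz (sub_nonneg.2 ih)
          ((hzd.pow_right m).sub_right ((Commute.refl z).pow_right m))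
      _ ≤ z * (z + algebraMap ℝ M δ) ^ m + algebraMap ℝ M δ * (z + algebraMap ℝ M δ) ^ m :=
        le_add_of_nonneg_right <| Commute.mul_nonneg hδ' (CStarAlgebra.pow_nonneg (add_nonneg hz hδ') m)
          (Algebra.commute_algebraMap_left δ _)
      _ = (z + algebraMap ℝ M δ) ^ (m + 1) := by rw [← add_mul, ← pow_succ']

theorem rpow_one_div_natCast_pow {h : M} (hh : 0 ≤ h) {n : ℕ} (hn : n ≠ 0) :
    (h ^ (1 / (n : ℝ))) ^ n = h := by
  have hn' : (n : ℝ) ≠ 0 := Nat.cast_ne_zero.2 hn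
  rw [← CFC.rpow_natCast _ n CFC.rpow_nonneg,
    CFC.rpow_rpow_of_exponent_nonneg h _ _ (by positivity) (by positivity),
    one_div_mul_cancel hn', CFC.rpow_one h]

/-! ### Trace inequalities -/

variable {τ : M →ₚ[ℂ] ℂ}

theorem trace_re_mul_nonneg (hτ : ∀ a b : M, τ (a * b) = τ (b * a)) {x y : M} (hx : 0 ≤ x)
    (hy : 0 ≤ y) : 0 ≤ (τ (x * y)).re := by
  have h : τ (x * y) = τ (CFC.sqrt x * y * CFC.sqrt x) := by
    rw [hτ (CFC.sqrt x * y), ← mul_assoc, CFC.sqrt_mul_sqrt_self x hx]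
  rw [h]
  exact (Complex.nonneg_iff.1 (map_nonneg τ
    (conjugate_nonneg_of_nonneg hy (CFC.sqrt_nonneg x)))).1

/-- The tangent line inequality for `x ↦ x^{1/(m+1)}` under a trace; here `e` is the inverse of `d`,
and the concavity is that of the function at `k^(m+1)` relative to the point `d^(m+1)`. -/
theorem mul_trace_le_trace_pow_mul_inv_pow (hτ : ∀ a b : M, τ (a * b) = τ (b * a)) {k d e : M}
    (hk : 0 ≤ k) (hd : 0 ≤ d) (he : 0 ≤ e) (hde : d * e = 1) (hed : e * d = 1) (m : ℕ) :
    ((m : ℝ) + 1) * (τ k).re ≤ (τ (k ^ (m + 1) * e ^ m)).re + m * (τ d).re := by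
  have hpow : ∀ j, e ^ (j + 1) * d = e ^ j := fun j => by rw [pow_succ, mul_assoc, hed, mul_one]
  have hpow' : ∀ j, d * e ^ (j + 1) = e ^ j := fun j => by
    rw [pow_succ', ← mul_assoc, hde, one_mul]
  have hconv := add_mul_sub_le_of_convex (a := fun j => (τ (k ^ j * (e ^ j * d))).re) (fun j => by
    -- The second difference at `j` is a trace of a product of two positive elements.
    have hpos : 0 ≤ (τ (k ^ j * ((k - d) * e ^ (j + 1) * (k - d)))).re :=
      trace_re_mul_nonneg hτ (CStarAlgebra.pow_nonneg hk j)
        (((IsSelfAdjoint.of_nonneg hk).sub (IsSelfAdjoint.of_nonneg hd)).conjugate_nonneg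
          (CStarAlgebra.pow_nonneg he _))
    have hexp : k ^ j * ((k - d) * e ^ (j + 1) * (k - d)) =
        k ^ (j + 1) * e ^ (j + 1) * k - k ^ (j + 1) * (e ^ (j + 1) * d) - k ^ j * e ^ j * k
          + k ^ j * (e ^ j * d) := by
      rw [sub_mul k d, hpow', mul_sub, sub_mul, sub_mul, pow_succ k]
      noncomm_ring
    have h₁ : τ (k ^ (j + 1) * e ^ (j + 1) * k) = τ (k ^ (j + 2) * (e ^ (j + 2) * d)) := by
      rw [hτ, ← mul_assoc, ← pow_succ', hpow]
    have h₂ : τ (k ^ j * e ^ j * k) = τ (k ^ (j + 1) * (e ^ (j + 1) * d)) := by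
      rw [hτ, ← mul_assoc, ← pow_succ', hpow]
    rw [hexp, map_add, map_sub, map_sub, h₁, h₂] at hpos
    simp only [Complex.add_re, Complex.sub_re] at hpos
    linarith) (m + 1)
  simp only [pow_zero, pow_one, one_mul, hed, mul_one, hpow, Nat.cast_add, Nat.cast_one] at hconv
  linarith

/-- The inductive step: splitting one factor off a product. The argument needs
`y⋆ y ≤ ((y⋆ y)^{1/m})^m`. For `m = 0`, where `1 / m` has the junk value `0` and the right-hand side is
`1`, this is the hypothesis `hy`. -/
theorem mul_trace_star_mul_mul_rpow_le (hτ : ∀ a b : M, τ (a * b) = τ (b * a)) (hτ₁ : τ 1 = 1)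
    {f : M} (hf : 0 ≤ f) (y : M) (m : ℕ) (hy : m = 0 → star y * y ≤ 1) :
    ((m : ℝ) + 1) * (τ ((star y * f * y) ^ (1 / ((m : ℝ) + 1)))).re ≤
      (τ f).re + m * (τ ((star y * y) ^ (1 / (m : ℝ)))).re := by
  have hz : 0 ≤ (star y * y) ^ (1 / (m : ℝ)) := CFC.rpow_nonneg
  set z := (star y * y) ^ (1 / (m : ℝ)) with hz_def
  set k := (star y * f * y) ^ (1 / ((m : ℝ) + 1)) with hk_def
  have hk : 0 ≤ k := CFC.rpow_nonneg
  have hkpow : k ^ (m + 1) = star y * f * y := by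
    have := rpow_one_div_natCast_pow (star_left_conjugate_nonneg hf y) m.succ_ne_zero
    rwa [Nat.cast_succ] at this
  have hzpow : star y * y ≤ z ^ m := by
    rcases eq_or_ne m 0 with h | h
    · simpa [h] using hy h
    · exact (rpow_one_div_natCast_pow (star_mul_self_nonneg y) h).ge
  have key : ∀ δ : ℝ, 0 < δ →
      ((m : ℝ) + 1) * (τ k).re ≤ (τ f).re + m * (τ z).re + m * δ := by
    intro δ hδ
    have hdpos : IsStrictlyPositive (z + algebraMap ℝ M δ) :=
      IsStrictlyPositive.nonneg_add hz (isStrictlyPositive_algebraMap hδ)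
    have hpow := pow_le_add_algebraMap_pow hz hδ.le m
    have htr : (τ (z + algebraMap ℝ M δ)).re = (τ z).re + δ := by
      have : algebraMap ℝ M δ = (δ : ℂ) • (1 : M) := by
        rw [Algebra.algebraMap_eq_smul_one, Complex.coe_smul]
      rw [this, map_add, map_smul, hτ₁]
      simp
    set d := z + algebraMap ℝ M δ
    have hde : d * d ^ (-1 : ℝ) = 1 := by
      simpa only [CFC.rpow_one d hdpos.nonneg] using CFC.rpow_mul_rpow_neg (a := d) 1 hdpos
    have hed : d ^ (-1 : ℝ) * d = 1 := by
      simpa only [CFC.rpow_one d hdpos.nonneg] using CFC.rpow_neg_mul_rpow (a := d) 1 hdpos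
    have he : 0 ≤ d ^ (-1 : ℝ) := CFC.rpow_nonneg
    set e := d ^ (-1 : ℝ)
    have hinv : e ^ m * d ^ m = 1 := by
      rw [← ((show Commute e d from hed.trans hde.symm).mul_pow m), hed, one_pow]
    have hcontr : y * e ^ m * star y ≤ 1 :=
      mul_mul_star_le_one (CStarAlgebra.pow_nonneg he m) hinv (hzpow.trans hpow)
    have htrace : (τ (k ^ (m + 1) * e ^ m)).re ≤ (τ f).re := by
      have h₁ : τ (k ^ (m + 1) * e ^ m) = τ (f * (y * e ^ m * star y)) := by
        rw [hkpow, mul_assoc, mul_assoc, hτ]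
        simp only [mul_assoc]
      have h₂ := trace_re_mul_nonneg hτ hf (sub_nonneg.2 hcontr)
      rw [mul_sub, mul_one, map_sub, Complex.sub_re] at h₂
      rw [h₁]
      linarith
    have hmain := mul_trace_le_trace_pow_mul_inv_pow hτ hk hdpos.nonneg he hde hed m
    rw [htr] at hmain
    linarith
  refine le_of_forall_pos_le_add fun ε hε => (key (ε / (m + 1)) (by positivity)).trans ?_
  have : (m : ℝ) * (ε / (m + 1)) ≤ ε := by
    rw [mul_div_assoc', div_le_iff₀ (by positivity)]
    nlinarith
  linarith

theorem length_mul_trace_prod_rpow_le_trace_sum (hτ : ∀ a b : M, τ (a * b) = τ (b * a))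
    (hτ₁ : τ 1 = 1) (l : List M) (hl : ∀ x ∈ l, 0 ≤ x) :
    (l.length : ℝ) * (τ ((star (l.map (· ^ (1 / 2 : ℝ))).prod *
      (l.map (· ^ (1 / 2 : ℝ))).prod) ^ (1 / (l.length : ℝ)))).re ≤ (τ l.sum).re := by
  induction l with
  | nil => simp
  | cons x l ih =>
    have hx : 0 ≤ x := hl x List.mem_cons_self
    have hsq : x ^ (1 / 2 : ℝ) * x ^ (1 / 2 : ℝ) = x := by
      rw [← CFC.sqrt_eq_rpow, CFC.sqrt_mul_sqrt_self x hx]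
    have hsa : star (x ^ (1 / 2 : ℝ)) = x ^ (1 / 2 : ℝ) :=
      (IsSelfAdjoint.of_nonneg CFC.rpow_nonneg).star_eq
    have ih' := ih fun w hw => hl w (List.mem_cons_of_mem _ hw)
    have hnil : l.length = 0 →
        star (l.map (· ^ (1 / 2 : ℝ))).prod * (l.map (· ^ (1 / 2 : ℝ))).prod ≤ 1 := by
      intro h
      simp [List.length_eq_zero_iff.1 h]
    rw [List.map_cons, List.prod_cons, List.sum_cons, List.length_cons]
    set y := (l.map (· ^ (1 / 2 : ℝ))).prod
    have hprod : star (x ^ (1 / 2 : ℝ) * y) * (x ^ (1 / 2 : ℝ) * y) = star y * x * y := by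
      rw [star_mul, hsa, mul_assoc, ← mul_assoc (x ^ (1 / 2 : ℝ)), hsq, ← mul_assoc]
    rw [hprod, map_add, Complex.add_re, Nat.cast_succ]
    exact (mul_trace_star_mul_mul_rpow_le hτ hτ₁ hx y l.length hnil).trans (by linarith)

end CStar

theorem propositiont {M : Type*} [CStarAlgebra M] [PartialOrder M] [StarOrderedRing M]
    (τ : M →ₚ[ℂ] ℂ) (hτ : IsTracialVonNeumannAlgebra M τ)
    (n : ℕ) (hn : 1 ≤ n) (f : Fin n → M) (hf : ∀ i, 0 ≤ f i) :
    τ (∑ i, f i) / (n : ℂ) ≥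
      τ ((star (List.ofFn fun i => f i ^ (1 / 2 : ℝ)).prod *
        (List.ofFn fun i => f i ^ (1 / 2 : ℝ)).prod) ^ (1 / (n : ℝ))) := by
  have hn' : (0 : ℝ) < n := Nat.cast_pos.2 hn
  have h := length_mul_trace_prod_rpow_le_trace_sum hτ.isFaithfulNormalTracialState.map_mul_comm
    hτ.isFaithfulNormalTracialState.map_one (List.ofFn f) (by simpa [List.mem_ofFn] using hf)
  rw [List.length_ofFn, List.map_ofFn, List.sum_ofFn] at h
  have him : ∀ x : M, 0 ≤ x → (τ x).im = 0 := fun x hx =>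
    (Complex.nonneg_iff.1 (map_nonneg τ hx)).2.symm
  refine Complex.le_def.2 ⟨?_, ?_⟩
  · rw [Complex.div_natCast_re, le_div_iff₀ hn', mul_comm]
    exact h
  · rw [Complex.div_natCast_im, him _ CFC.rpow_nonneg, him _ (Finset.sum_nonneg fun i _ => hf i),
      zero_div]
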